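/- **Canonicity of simple independence relations.** On an AECat with the amalgamation property there is at most one simple independence relation. Here the notions are as follows. *AECat.* An AECat $(\mathcal C,\mathcal M)$ consists of an accessible category $\mathcal C$ and a full subcategory $\mathcal M$ of $\mathcal C$ (whose objects are called models) that is also accessible, such that $\mathcal M$ has directed colimits (over non-empty directed posets), the inclusion $\mathcal M\hookrightarrow\mathcal C$ preserves them, and all arrows of $\mathcal C$ are monomorphisms. It has the amalgamation property if for every span $N_1\xleftarrow{f_1}M\xrightarrow{f_2}N_2$ of models there are arrows $N_1\xrightarrow{g_1}U\xleftarrow{g_2}N_2$ into a model $U$ with $g_1f_1=g_2f_2$. An extension of a model $M$ is an arrow $M\to N$ with $N$ a model; arrows into $M$ and subobjects of $M$ are regarded as arrows into, respectively subobjects of, $N$ by composition with it. *Galois types.* Let $M, M'$ be models. Tuples of arrows $(a_i\colon A_i\to M)_i$ and $(a_i'\colon A_i\to M')_i$ have the same Galois type, written $\mathrm{gtp}((a_i)_i;M)=\mathrm{gtp}((a_i')_i;M')$, if there are extensions $f\colon M\to N$ and $g\colon M'\to N$ with $fa_i=ga_i'$ for all $i$. Tuples of subobjects $(A_i)_i$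 of $M$ and $(A'_i)_i$ of $M'$ have the same Galois type if there are extensions $M\to N\leftarrow M'$ such that $A_i=A_i'$ as subobjects of $N$ for all $i$. *Simple independence relations.* An independence relation is a relation on triples of subobjects of models; we write $A\perp^M_C B$ if the triple $(A,B,C)$ of subobjects of the model $M$ is in the relation. It is simple if it has all of the following properties. - Invariance: if $A\perp^M_C B$ and $\mathrm{gtp}(A,B,C;M)=\mathrm{gtp}(A',B',C';M')$, then $A'\perp^{M'}_{C'}B'$. - Monotonicity: if $A\perp^M_C B$ and $B'\le B$, then $A\perp^M_C B'$. - Base-monotonicity: if $A\perp^M_C B$ and $C\le C'\le B$, then $A\perp^M_{C'}B$. - Transitivity: if $B\le C$, $A\perp^M_B C$ and $A\perp^M_C D$, then there are an extension $M\to N$ and $E\le N$ with $C,D\le E$ and $A\perp^N_B E$. - Symmetry: if $A\perp^M_C B$, then $B\perp^M_C A$. - Existence: for all arrows $a\colon A\to M$ and $c\colon C\to M$ into a model $M$ and every $B\le M$ there are an extension $M\to M'$ and an arrow $a'\colon A\to M'$, representing a subobject $A'$, such that $A'\perp^{M'}_C B$ and $\mathrm{gtp}(a',c;M')=\mathrm{gtp}(a,c;M)$.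 - Union: if $(B_i)_{i\in I}$ is a directed system in $\mathcal C$ over a non-empty directed poset $I$, with a cocone into a model $M$ and with a colimit $B$ in $\mathcal C$, and if $A\perp^M_C B_i$ for all $i\in I$, then $A\perp^M_C B$. - Local character: for every regular infinite cardinal $\lambda$ there is a regular infinite cardinal $\Upsilon(\lambda)$ such that for every model $M$ and all $A,B\le M$ with $A$ $\lambda$-presentable there is a $\Upsilon(\lambda)$-presentable $B'\le B$ with $A\perp^M_{B'}B$. - 3-amalgamation: let $M,N_1,N_2,N_3$ be models, with arrows $m_i\colon M\to N_i$ ($i=1,2,3$), $a_i\colon A\to N_i$ ($i=1,3$), $b_i\colon B\to N_i$ ($i=1,2$) and $c_i\colon C\to N_i$ ($i=2,3$). If, for the subobjects represented by these arrows, $A\perp^{N_1}_M B$, $B\perp^{N_2}_M C$ and $C\perp^{N_3}_M A$, and if $\mathrm{gtp}(a_1,m_1;N_1)=\mathrm{gtp}(a_3,m_3;N_3)$, $\mathrm{gtp}(b_1,m_1;N_1)=\mathrm{gtp}(b_2,m_2;N_2)$ and $\mathrm{gtp}(c_2,m_2;N_2)=\mathrm{gtp}(c_3,m_3;N_3)$,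 then there are extensions $f_i\colon N_i\to N$ ($i=1,2,3$) into one model $N$ with $f_1a_1=f_3a_3$, $f_1b_1=f_2b_2$, $f_2c_2=f_3c_3$, $f_1m_1=f_2m_2=f_3m_3$ and $A\perp^N_M N_2$. The claim is: if $(\mathcal C,\mathcal M)$ is an AECat with the amalgamation property and $\perp^{(1)}$ and $\perp^{(2)}$ are simple independence relations on it, then $\perp^{(1)}=\perp^{(2)}$, that is, for every model $M$ and all $A,B,C\le M$, $A\perp^{(1),M}_C B$ if and only if $A\perp^{(2),M}_C B$. -/

import Mathlib

open CategoryTheory CategoryTheory.Limits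

universe w u

/-- An AECat: an accessible category `C` with a full subcategory of models (given by a property of
objects) that is itself accessible and has directed colimits, which the inclusion into `C`
preserves, such that all arrows of `C` are monomorphisms. -/
class AECat (C : Type u) [Category.{w} C] where
  /-- The property of being a model. -/
  isModel : ObjectProperty C
  accessible : IsAccessibleCategory.{w} C
  accessible_models : IsAccessibleCategory.{w} isModel.FullSubcategory
  hasDirectedColimits (J : Type w) [PartialOrder J] [IsDirectedOrder J] [Nonempty J] :
    HasColimitsOfShape J isModel.FullSubcategory
  preservesDirectedColimits (J : Type w) [PartialOrder J] [IsDirectedOrder J] [Nonempty J] :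
    PreservesColimitsOfShape J isModel.ι
  mono {X Y : C} (f : X ⟶ Y) : Mono f

namespace AECat

attribute [instance] AECat.mono

/-- The models of an AECat, as objects of the full subcategory. For `M : Model C`, the underlying
object of `C` is `M.obj`. An extension of `M` is an arrow `M.obj ⟶ N.obj` with `N` a model. -/
abbrev Model (C : Type u) [Category.{w} C] [AECat C] : Type u :=
  (isModel (C := C)).FullSubcategory

variable {C : Type u} [Category.{w} C] [AECat C]

/-- The amalgamation property: every span of models can be completed to a commutative square of
models. -/
def AmalgamationProperty (C : Type u) [Category.{w} C] [AECat C] : Prop :=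
  ∀ (M N₁ N₂ : Model C) (f₁ : M.obj ⟶ N₁.obj) (f₂ : M.obj ⟶ N₂.obj),
    ∃ (U : Model C) (g₁ : N₁.obj ⟶ U.obj) (g₂ : N₂.obj ⟶ U.obj), f₁ ≫ g₁ = f₂ ≫ g₂

/-- The pairs of arrows `(a, b; M)` and `(a', b'; M')` have the same Galois type. -/
def SameGaloisType {A B : C} {M M' : Model C} (a : A ⟶ M.obj) (b : B ⟶ M.obj)
    (a' : A ⟶ M'.obj) (b' : B ⟶ M'.obj) : Prop :=
  ∃ (N : Model C) (f : M.obj ⟶ N.obj) (g : M'.obj ⟶ N.obj), a ≫ f = a' ≫ g ∧ b ≫ f = b' ≫ g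

/-- A subobject of `X`, viewed as a subobject of `Y` by composition with the (mono)morphism
`f : X ⟶ Y`. -/
noncomputable def push {X Y : C} (f : X ⟶ Y) (A : Subobject X) : Subobject Y :=
  (Subobject.map f).obj A

/-- The triples of subobjects `(A, B, D; M)` and `(A', B', D'; M')` have the same Galois type. -/
def SameGaloisTypeSub {M M' : Model C} (A B D : Subobject M.obj) (A' B' D' : Subobject M'.obj) :
    Prop :=
  ∃ (N : Model C) (f : M.obj ⟶ N.obj) (g : M'.obj ⟶ N.obj),
    push f A = push g A' ∧ push f B = push g B' ∧ push f D = push g D'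

/-- An independence relation: a relation on triples of subobjects of models. For such a relation
`R`, we read `R M A B D` as "`A` is independent from `B` over `D` in `M`"; the base comes last. -/
abbrev IndependenceRelation (C : Type u) [Category.{w} C] [AECat C] : Type (max u w) :=
  ∀ M : Model C, Subobject M.obj → Subobject M.obj → Subobject M.obj → Prop

namespace IndependenceRelation

variable (R : IndependenceRelation C)

def Invariance : Prop :=
  ∀ (M M' : Model C) (A B D : Subobject M.obj) (A' B' D' : Subobject M'.obj),
    R M A B D → SameGaloisTypeSub A B D A' B' D' → R M' A' B' D'

def Monotonicity : Prop :=
  ∀ (M : Model C) (A B B' D : Subobject M.obj), R M A B D → B' ≤ B → R M A B' D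

def BaseMonotonicity : Prop :=
  ∀ (M : Model C) (A B D D' : Subobject M.obj), R M A B D → D ≤ D' → D' ≤ B → R M A B D'

/-- The bases are nested: `B ≤ D`. -/
def Transitivity : Prop :=
  ∀ (M : Model C) (A B D F : Subobject M.obj), B ≤ D → R M A D B → R M A F D →
    ∃ (N : Model C) (f : M.obj ⟶ N.obj) (E : Subobject N.obj),
      R N (push f A) E (push f B) ∧ push f D ≤ E ∧ push f F ≤ E

def Symmetry : Prop :=
  ∀ (M : Model C) (A B D : Subobject M.obj), R M A B D → R M B A D

def Existence : Prop :=
  ∀ (M : Model C) (A D : C) (a : A ⟶ M.obj) (d : D ⟶ M.obj) (B : Subobject M.obj),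
    ∃ (M' : Model C) (f : M.obj ⟶ M'.obj) (a' : A ⟶ M'.obj),
      R M' (Subobject.mk a') (push f B) (Subobject.mk (d ≫ f)) ∧
        SameGaloisType a' (d ≫ f) a d

/-- `F` is a directed system in `C` with colimit `c.pt`; its cocones with vertex `M` correspond to
the arrows `b` from the colimit to `M`. -/
def Union : Prop :=
  ∀ (M : Model C) (A D : Subobject M.obj) (I : Type w) [PartialOrder I] [IsDirectedOrder I]
    [Nonempty I] (F : I ⥤ C) (c : Cocone F) (_ : IsColimit c) (b : c.pt ⟶ M.obj),
    (∀ i : I, R M A (Subobject.mk (c.ι.app i ≫ b)) D) → R M A (Subobject.mk b) D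

def LocalCharacter : Prop :=
  ∀ (κ : Cardinal.{w}) [Fact κ.IsRegular], ∃ (υ : Cardinal.{w}) (_ : Fact υ.IsRegular),
    ∀ (M : Model C) (A B : Subobject M.obj), IsCardinalPresentable (A : C) κ →
      ∃ B' : Subobject M.obj, B' ≤ B ∧ IsCardinalPresentable (B' : C) υ ∧ R M A B B'

def ThreeAmalgamation : Prop :=
  ∀ (A B D : C) (M N₁ N₂ N₃ : Model C)
    (a₁ : A ⟶ N₁.obj) (b₁ : B ⟶ N₁.obj) (m₁ : M.obj ⟶ N₁.obj)
    (b₂ : B ⟶ N₂.obj) (d₂ : D ⟶ N₂.obj) (m₂ : M.obj ⟶ N₂.obj)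
    (d₃ : D ⟶ N₃.obj) (a₃ : A ⟶ N₃.obj) (m₃ : M.obj ⟶ N₃.obj),
    R N₁ (Subobject.mk a₁) (Subobject.mk b₁) (Subobject.mk m₁) →
    R N₂ (Subobject.mk b₂) (Subobject.mk d₂) (Subobject.mk m₂) →
    R N₃ (Subobject.mk d₃) (Subobject.mk a₃) (Subobject.mk m₃) →
    SameGaloisType a₁ m₁ a₃ m₃ →
    SameGaloisType b₁ m₁ b₂ m₂ →
    SameGaloisType d₂ m₂ d₃ m₃ →
    ∃ (N : Model C) (f₁ : N₁.obj ⟶ N.obj) (f₂ : N₂.obj ⟶ N.obj) (f₃ : N₃.obj ⟶ N.obj),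
      a₁ ≫ f₁ = a₃ ≫ f₃ ∧ b₁ ≫ f₁ = b₂ ≫ f₂ ∧ d₂ ≫ f₂ = d₃ ≫ f₃ ∧
      m₁ ≫ f₁ = m₂ ≫ f₂ ∧ m₂ ≫ f₂ = m₃ ≫ f₃ ∧
      R N (Subobject.mk (a₁ ≫ f₁)) (Subobject.mk f₂) (Subobject.mk (m₁ ≫ f₁))

/-- A simple independence relation. -/
structure IsSimple : Prop where
  invariance : Invariance R
  monotonicity : Monotonicity R
  baseMonotonicity : BaseMonotonicity R
  transitivity : Transitivity R
  symmetry : Symmetry R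
  existence : Existence R
  union : Union R
  localCharacter : LocalCharacter R
  threeAmalgamation : ThreeAmalgamation R

end IndependenceRelation

end AECat

namespace AECat

variable {C : Type u} [Category.{w} C] [AECat C]

/-! The argument is of Kim–Pillay type. Over a model `M₀`, suppose that `a` and `b` are independent
for `R₂`. Build a long continuous chain of models `M_i` over `M₀` in which `M_{i+1}` contains a copy
`b_i` of `b`, independent from `M_i` over `M₀` for both relations. Alongside, 3-amalgamation for
`R₂` keeps a copy of `a` that is `R₂`-independent from `M_i` and forms with each earlier `b_i` a
copy of the pair `(a, b)` over `M₀`. Local character of `R₁` makes `a` `R₁`-independent from the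
union of the chain over some `M_i`. As `b_i` is `R₁`-independent from `M_i` over `M₀`, symmetry and
transitivity make it `R₁`-independent from `a` over `M₀`; by invariance so are `a` and `b`
(`ind_of_ind_model`).

The doubly independent copies (`exists_ind_ind`) come from a similar chain: its steps are
independent for `R₂`, existence for `R₁` is applied over its union, and local character of `R₂`
selects the stage.

For an arbitrary base, `ind_of_ind` inserts a model above the base and descends by transitivity. -/

lemma push_mk {X Y A : C} (f : X ⟶ Y) (a : A ⟶ X) :
    push f (Subobject.mk a) = Subobject.mk (a ≫ f) :=
  Subobject.map_mk a f

lemma SameGaloisType.comp {A B : C} {M M' : Model C} {a : A ⟶ M.obj} {b : B ⟶ M.obj}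
    {a' : A ⟶ M'.obj} {b' : B ⟶ M'.obj} (hAP : AmalgamationProperty C)
    (h : SameGaloisType a b a' b') {N : Model C} (f : M.obj ⟶ N.obj) :
    SameGaloisType (a ≫ f) (b ≫ f) a' b' := by
  obtain ⟨U, g, g', ha, hb⟩ := h
  obtain ⟨V, v, v', hv⟩ := hAP M N U f g
  exact ⟨V, v, g' ≫ v', by simp [hv, reassoc_of% ha], by simp [hv, reassoc_of% hb]⟩

lemma SameGaloisType.symm {A B : C} {M M' : Model C} {a : A ⟶ M.obj} {b : B ⟶ M.obj}
    {a' : A ⟶ M'.obj} {b' : B ⟶ M'.obj} (h : SameGaloisType a b a' b') :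
    SameGaloisType a' b' a b := by
  obtain ⟨U, g, g', ha, hb⟩ := h
  exact ⟨U, g', g, ha.symm, hb.symm⟩

/-! ### Calculus of independence for arrows -/

namespace IndependenceRelation

/-- Independence of subobjects of a model represented by arrows into it; the base comes last. -/
def Ind (R : IndependenceRelation C) {M : Model C} {A B D : C}
    (a : A ⟶ M.obj) (b : B ⟶ M.obj) (d : D ⟶ M.obj) : Prop :=
  R M (Subobject.mk a) (Subobject.mk b) (Subobject.mk d)

variable {R : IndependenceRelation C} {M N : Model C} {A B D E : C}
  {a : A ⟶ M.obj} {b : B ⟶ M.obj} {d : D ⟶ M.obj}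

lemma Invariance.ind_comp (hR : R.Invariance) (h : R.Ind a b d) (f : M.obj ⟶ N.obj) :
    R.Ind (a ≫ f) (b ≫ f) (d ≫ f) :=
  hR _ _ _ _ _ _ _ _ h ⟨N, f, 𝟙 _, by simp [push_mk], by simp [push_mk], by simp [push_mk]⟩

lemma Invariance.ind_of_comp (hR : R.Invariance) (f : M.obj ⟶ N.obj)
    (h : R.Ind (a ≫ f) (b ≫ f) (d ≫ f)) : R.Ind a b d :=
  hR _ _ _ _ _ _ _ _ h ⟨N, 𝟙 _, f, by simp [push_mk], by simp [push_mk], by simp [push_mk]⟩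

lemma Monotonicity.ind (hR : R.Monotonicity) (h : R.Ind a b d) (x : E ⟶ B) :
    R.Ind a (x ≫ b) d :=
  hR _ _ _ _ _ h (Subobject.mk_le_mk_of_comm x rfl)

namespace IsSimple

lemma ind_symm (hR : R.IsSimple) (h : R.Ind a b d) : R.Ind b a d :=
  hR.symmetry _ _ _ _ h

/-- Unfolding the Galois type in existence turns the new copy of `a` into the image of `a` under a
second embedding of all of `M`. -/
lemma exists_ind (hR : R.IsSimple) (a : A ⟶ M.obj) (b : B ⟶ M.obj) (d : D ⟶ M.obj) :
    ∃ (N : Model C) (f g : M.obj ⟶ N.obj), d ≫ f = d ≫ g ∧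
      R.Ind (a ≫ g) (b ≫ f) (d ≫ f) := by
  obtain ⟨M', f, a', h, N, p, q, ha, hd⟩ := hR.existence M A D a d (Subobject.mk b)
  rw [push_mk] at h
  refine ⟨N, f ≫ p, q, by simpa using hd, ?_⟩
  have := hR.invariance.ind_comp h p
  rwa [ha, Category.assoc, Category.assoc] at this

/-- Existence gives this for some copy of `a` over `d`, and invariance brings it back. -/
lemma ind_base (hR : R.IsSimple) (a : A ⟶ M.obj) (d : D ⟶ M.obj) : R.Ind a d d := by
  obtain ⟨N, f, g, hd, h⟩ := hR.exists_ind a d d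
  rw [hd] at h
  exact hR.invariance.ind_of_comp g h

lemma ind_of_le (hR : R.IsSimple) {M : Model C} {A B : C} {a : A ⟶ M.obj} {b : B ⟶ M.obj}
    {S : Subobject M.obj} (h : R M (Subobject.mk a) (Subobject.mk b) S) {E : C}
    (e : E ⟶ M.obj) (x : E ⟶ B) (hx : x ≫ b = e) (hS : S ≤ Subobject.mk e) : R.Ind a b e :=
  hR.baseMonotonicity _ _ _ _ _ h hS (Subobject.mk_le_mk_of_comm x hx)

lemma exists_ind_trans (hR : R.IsSimple) {e : E ⟶ M.obj} (x : D ⟶ B)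
    (h₁ : R.Ind a b (x ≫ b)) (h₂ : R.Ind a e b) :
    ∃ (N : Model C) (f : M.obj ⟶ N.obj) (F : C) (t : F ⟶ N.obj) (y : B ⟶ F) (z : E ⟶ F),
      R.Ind (a ≫ f) t (x ≫ b ≫ f) ∧ y ≫ t = b ≫ f ∧ z ≫ t = e ≫ f := by
  obtain ⟨N, f, S, h, hb, he⟩ := hR.transitivity _ _ _ _ _
    (Subobject.mk_le_mk_of_comm x rfl) h₁ h₂
  simp only [push_mk] at h hb he
  rw [← Subobject.mk_arrow S] at h hb he
  refine ⟨N, f, _, S.arrow, Subobject.ofMkLEMk _ _ hb, Subobject.ofMkLEMk _ _ he, ?_, ?_, ?_⟩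
  · simpa [Ind] using h
  · exact Subobject.ofMkLEMk_comp hb
  · exact Subobject.ofMkLEMk_comp he

/-- The usual transitivity: the extension and the larger subobject in the axiom are removed by
monotonicity and invariance. -/
lemma ind_trans (hR : R.IsSimple) {e : E ⟶ M.obj} (x : D ⟶ B)
    (h₁ : R.Ind a b (x ≫ b)) (h₂ : R.Ind a e b) : R.Ind a e (x ≫ b) := by
  obtain ⟨N, f, F, t, y, z, h, hy, hz⟩ := hR.exists_ind_trans x h₁ h₂
  have := hR.monotonicity.ind h z
  rw [hz] at this
  apply hR.invariance.ind_of_comp f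
  simpa using this

/-- A form of local character: a bounded part of `B`, the colimit of a long enough chain, suffices
as a base. -/
lemma exists_cardinal (hR : R.IsSimple) (A : C) :
    ∃ (κ : Cardinal.{w}) (_ : Fact κ.IsRegular), ∀ (J : Type w) [LinearOrder J]
      [IsCardinalFiltered J κ] (F : J ⥤ C) (c : Cocone F) (_ : IsColimit c) (M : Model C)
      (a : A ⟶ M.obj) (b : c.pt ⟶ M.obj), ∃ j : J, R.Ind a b (c.ι.app j ≫ b) := by
  have := AECat.accessible (C := C)
  obtain ⟨κ₀, hκ₀, hA⟩ : ∃ (κ : Cardinal.{w}) (_ : Fact κ.IsRegular),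
      IsCardinalPresentable A κ := by
    obtain ⟨κ, hκ, h⟩ := (inferInstance : IsPresentable.{w} A).exists_cardinal
    exact ⟨κ, hκ, ⟨h.1⟩⟩
  obtain ⟨κ, hκ, h⟩ := hR.localCharacter κ₀
  refine ⟨κ, hκ, fun J _ _ F c hc M a b ↦ ?_⟩
  obtain ⟨S, hS, hS', h'⟩ := h M (Subobject.mk a) (Subobject.mk b)
    (isCardinalPresentable_of_iso (Subobject.underlyingIso a).symm κ₀)
  -- The small base given by local character factors through a stage of the `κ`-filtered chain;
  -- base-monotonicity then enlarges it to that stage.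
  obtain ⟨j, y, hy⟩ := IsCardinalPresentable.exists_hom_of_isColimit κ hc
    (Subobject.ofLEMk S b hS)
  refine ⟨j, hR.ind_of_le h' _ (c.ι.app j) rfl ?_⟩
  refine Subobject.le_mk_of_comm y ?_
  rw [← Category.assoc, hy, Subobject.ofLEMk_comp]

end IsSimple

end IndependenceRelation

/-! ### Pointed spans: their directed colimits and chains -/

instance (J : Type w) [PartialOrder J] [IsDirectedOrder J] [Nonempty J] :
    HasColimitsOfShape J (isModel (C := C)).FullSubcategory :=
  hasDirectedColimits J

instance (J : Type w) [PartialOrder J] [IsDirectedOrder J] [Nonempty J] :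
    PreservesColimitsOfShape J (isModel (C := C)).ι :=
  preservesDirectedColimits J

/-- Two extensions `N` and `K` of a model `M`, together with arrows from `D`, `B` and `A` into
`M`, `N` and `K` respectively. -/
structure PointedSpan (D B A : C) where
  M : Model C
  N : Model C
  K : Model C
  m : M ⟶ N
  k : M ⟶ K
  d : D ⟶ M.obj
  b : B ⟶ N.obj
  a : A ⟶ K.obj

namespace PointedSpan

variable {D B A : C}

/-- Arrows of the three models which commute with all the data. -/
@[ext]
structure Hom (X Y : PointedSpan D B A) where
  M : X.M ⟶ Y.M
  N : X.N ⟶ Y.N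
  K : X.K ⟶ Y.K
  m_comm : X.m ≫ N = M ≫ Y.m
  k_comm : X.k ≫ K = M ≫ Y.k
  d_comm : X.d ≫ M.hom = Y.d
  b_comm : X.b ≫ N.hom = Y.b
  a_comm : X.a ≫ K.hom = Y.a

instance : Category (PointedSpan D B A) where
  Hom := Hom
  id X := ⟨𝟙 _, 𝟙 _, 𝟙 _, by simp, by simp, by simp, by simp, by simp⟩
  comp f g := ⟨f.M ≫ g.M, f.N ≫ g.N, f.K ≫ g.K,
    by rw [reassoc_of% f.m_comm, g.m_comm, Category.assoc],
    by rw [reassoc_of% f.k_comm, g.k_comm, Category.assoc],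
    by rw [ObjectProperty.FullSubcategory.comp_hom, reassoc_of% f.d_comm, g.d_comm],
    by rw [ObjectProperty.FullSubcategory.comp_hom, reassoc_of% f.b_comm, g.b_comm],
    by rw [ObjectProperty.FullSubcategory.comp_hom, reassoc_of% f.a_comm, g.a_comm]⟩

@[ext]
lemma hom_ext {X Y : PointedSpan D B A} {f g : X ⟶ Y} (hM : f.M = g.M) (hN : f.N = g.N)
    (hK : f.K = g.K) : f = g :=
  Hom.ext hM hN hK

/-- The model `M` of a pointed span, as a functor. -/
def projM : PointedSpan D B A ⥤ Model C where
  obj X := X.M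
  map f := f.M

/-- The model `N` of a pointed span, as a functor. -/
def projN : PointedSpan D B A ⥤ Model C where
  obj X := X.N
  map f := f.N

/-- The model `K` of a pointed span, as a functor. -/
def projK : PointedSpan D B A ⥤ Model C where
  obj X := X.K
  map f := f.K

/-- The extension of `M` by `N`, as a natural transformation. -/
def transN : projM (D := D) (B := B) (A := A) ⟶ projN where
  app X := X.m
  naturality _ _ f := f.m_comm.symm

/-- The extension of `M` by `K`, as a natural transformation. -/
def transK : projM (D := D) (B := B) (A := A) ⟶ projK where
  app X := X.k
  naturality _ _ f := f.k_comm.symm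

section Colimits

variable {J : Type w} [PartialOrder J] [IsDirectedOrder J]

lemma comp_ι_app_eq {G : J ⥤ Model C} (c : Cocone G) {X : C} (x : ∀ j, X ⟶ (G.obj j).obj)
    (hx : ∀ (i j : J) (f : i ⟶ j), x i ≫ (G.map f).hom = x j) (i j : J) :
    x i ≫ (c.ι.app i).hom = x j ≫ (c.ι.app j).hom := by
  obtain ⟨l, hi, hj⟩ := exists_ge_ge i j
  have key (i : J) (h : i ≤ l) : x i ≫ (c.ι.app i).hom = x l ≫ (c.ι.app l).hom := by
    rw [← hx i l (homOfLE h), Category.assoc]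
    exact congrArg (fun f ↦ x i ≫ f.hom) (c.w (homOfLE h)).symm
  rw [key i hi, key j hj]

variable [Nonempty J] (F : J ⥤ PointedSpan D B A)

/-- The componentwise colimit of a directed diagram of pointed spans. -/
noncomputable def colimitCocone : Cocone F where
  pt :=
    { M := colimit (F ⋙ projM)
      N := colimit (F ⋙ projN)
      K := colimit (F ⋙ projK)
      m := colimMap (Functor.whiskerLeft F transN)
      k := colimMap (Functor.whiskerLeft F transK)
      d := (F.obj (Classical.arbitrary J)).d ≫ (colimit.ι (F ⋙ projM) (Classical.arbitrary J)).hom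
      b := (F.obj (Classical.arbitrary J)).b ≫ (colimit.ι (F ⋙ projN) (Classical.arbitrary J)).hom
      a := (F.obj (Classical.arbitrary J)).a ≫
        (colimit.ι (F ⋙ projK) (Classical.arbitrary J)).hom }
  ι :=
    { app j :=
        { M := colimit.ι (F ⋙ projM) j
          N := colimit.ι (F ⋙ projN) j
          K := colimit.ι (F ⋙ projK) j
          m_comm := (ι_colimMap (Functor.whiskerLeft F transN) j).symm
          k_comm := (ι_colimMap (Functor.whiskerLeft F transK) j).symm
          d_comm := comp_ι_app_eq (colimit.cocone (F ⋙ projM)) (fun j ↦ (F.obj j).d)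
            (fun i j f ↦ (F.map f).d_comm) _ _
          b_comm := comp_ι_app_eq (colimit.cocone (F ⋙ projN)) (fun j ↦ (F.obj j).b)
            (fun i j f ↦ (F.map f).b_comm) _ _
          a_comm := comp_ι_app_eq (colimit.cocone (F ⋙ projK)) (fun j ↦ (F.obj j).a)
            (fun i j f ↦ (F.map f).a_comm) _ _ }
      naturality i j f := by
        ext1
        · exact (colimit.w (F ⋙ projM) f).trans (Category.comp_id _).symm
        · exact (colimit.w (F ⋙ projN) f).trans (Category.comp_id _).symm
        · exact (colimit.w (F ⋙ projK) f).trans (Category.comp_id _).symm }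

/-- `colimitCocone F` is a colimit cocone. -/
noncomputable def isColimitColimitCocone : IsColimit (colimitCocone F) where
  desc s :=
    { M := colimit.desc (F ⋙ projM) (projM.mapCocone s)
      N := colimit.desc (F ⋙ projN) (projN.mapCocone s)
      K := colimit.desc (F ⋙ projK) (projK.mapCocone s)
      m_comm := colimit.hom_ext fun j ↦
        (ι_colimMap_assoc (Functor.whiskerLeft F transN) j _).trans
          ((congrArg (_ ≫ ·) (colimit.ι_desc (projN.mapCocone s) j)).trans
            ((s.ι.app j).m_comm.trans
              (colimit.ι_desc_assoc (projM.mapCocone s) j _).symm))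
      k_comm := colimit.hom_ext fun j ↦
        (ι_colimMap_assoc (Functor.whiskerLeft F transK) j _).trans
          ((congrArg (_ ≫ ·) (colimit.ι_desc (projK.mapCocone s) j)).trans
            ((s.ι.app j).k_comm.trans
              (colimit.ι_desc_assoc (projM.mapCocone s) j _).symm))
      d_comm := (Category.assoc _ _ _).trans ((congrArg (fun f ↦ _ ≫ f.hom)
        (colimit.ι_desc (projM.mapCocone s) (Classical.arbitrary J))).trans
          (s.ι.app (Classical.arbitrary J)).d_comm)
      b_comm := (Category.assoc _ _ _).trans ((congrArg (fun f ↦ _ ≫ f.hom)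
        (colimit.ι_desc (projN.mapCocone s) (Classical.arbitrary J))).trans
          (s.ι.app (Classical.arbitrary J)).b_comm)
      a_comm := (Category.assoc _ _ _).trans ((congrArg (fun f ↦ _ ≫ f.hom)
        (colimit.ι_desc (projK.mapCocone s) (Classical.arbitrary J))).trans
          (s.ι.app (Classical.arbitrary J)).a_comm) }
  fac s j := by
    ext1
    · exact colimit.ι_desc (projM.mapCocone s) j
    · exact colimit.ι_desc (projN.mapCocone s) j
    · exact colimit.ι_desc (projK.mapCocone s) j
  uniq s m hm := by
    ext1
    · exact colimit.hom_ext fun j ↦ (congrArg Hom.M (hm j)).trans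
        (colimit.ι_desc (projM.mapCocone s) j).symm
    · exact colimit.hom_ext fun j ↦ (congrArg Hom.N (hm j)).trans
        (colimit.ι_desc (projN.mapCocone s) j).symm
    · exact colimit.hom_ext fun j ↦ (congrArg Hom.K (hm j)).trans
        (colimit.ι_desc (projK.mapCocone s) j).symm

instance : HasColimitsOfShape J (PointedSpan D B A) where
  has_colimit F := ⟨⟨_, isColimitColimitCocone F⟩⟩

instance : PreservesColimitsOfShape J (projM (D := D) (B := B) (A := A)) where
  preservesColimit {F} := preservesColimit_of_preserves_colimit_cocone (isColimitColimitCocone F)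
    (IsColimit.ofIsoColimit (colimit.isColimit (F ⋙ projM)) (Cocone.ext (Iso.refl _)
      fun _ ↦ Category.comp_id _))

end Colimits

/-- Iterating a step relation `W` on the pointed spans with a property `P` which is stable under
colimits of chains. -/
lemma exists_chain (P : ObjectProperty (PointedSpan D B A))
    (W : MorphismProperty (PointedSpan D B A))
    (hP : ∀ (J : Type w) [LinearOrder J] [Nonempty J] (F : J ⥤ PointedSpan D B A) (c : Cocone F)
      (_ : IsColimit c), (∀ j, P (F.obj j)) → P c.pt)
    (hW : ∀ X, P X → ∃ (Y : PointedSpan D B A) (f : X ⟶ Y), P Y ∧ W f)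
    (X₀ : PointedSpan D B A) (hX₀ : P X₀)
    (J : Type w) [LinearOrder J] [Nonempty J] [WellFoundedLT J] [NoMaxOrder J] :
    ∃ (F : J ⥤ PointedSpan D B A) (c : Cocone F) (_ : IsColimit c),
      P c.pt ∧ (∀ j, P (F.obj j)) ∧ ∀ i : J, ∃ (j : J) (f : i ⟶ j), W (F.map f) := by
  classical
  have hP (J : Type w) [LinearOrder J] [Nonempty J] : P.IsClosedUnderColimitsOfShape J :=
    ⟨fun _ ⟨h⟩ ↦ hP J h.diag h.cocone h.isColimit h.prop_diag_obj⟩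
  let _ : SuccOrder J := SuccOrder.ofLinearWellFoundedLT J
  let _ : OrderBot J := WellFoundedLT.toOrderBot J
  choose Y f hY hf using hW
  -- The iteration runs inside the full subcategory cut out by `P`, so that `P` is available both at
  -- successors and at limits.
  let Φ : SmallObject.SuccStruct P.FullSubcategory :=
    { X₀ := ⟨X₀, hX₀⟩
      succ X := ⟨Y X.obj X.property, hY _ _⟩
      toSucc X := ObjectProperty.homMk (f X.obj X.property) }
  have : HasIterationOfShape J P.FullSubcategory :=
    { hasColimitsOfShape_of_isSuccLimit j hj := by
        have := hj.nonempty_Iio.to_subtype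
        have := hP (Set.Iio j)
        infer_instance
      hasColimitsOfShape := by
        have := hP J
        infer_instance }
  have := hP J
  refine ⟨Φ.iterationFunctor J ⋙ P.ι, P.ι.mapCocone (Φ.iterationCocone J),
    isColimitOfPreserves P.ι (Φ.isColimitIterationCocone J), (Φ.iterationCocone J).pt.property,
    fun j ↦ ((Φ.iterationFunctor J).obj j).property, fun i ↦
    ⟨Order.succ i, homOfLE (Order.le_succ i), ?_⟩⟩
  have h := Φ.prop_iterationFunctor_map_succ i (not_isMax i)
  suffices Φ.prop ≤ W.inverseImage P.ι from this _ h
  rintro _ _ _ ⟨X⟩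
  exact hf _ _

variable {X Y : PointedSpan D B A} (f : X ⟶ Y)

lemma m_hom_comm : X.m.hom ≫ f.N.hom = f.M.hom ≫ Y.m.hom :=
  congrArg (·.hom) f.m_comm

lemma k_hom_comm : X.k.hom ≫ f.K.hom = f.M.hom ≫ Y.k.hom :=
  congrArg (·.hom) f.k_comm

lemma d_m_comm : (X.d ≫ X.m.hom) ≫ f.N.hom = Y.d ≫ Y.m.hom := by
  rw [Category.assoc, m_hom_comm, reassoc_of% f.d_comm]

lemma d_k_comm : (X.d ≫ X.k.hom) ≫ f.K.hom = Y.d ≫ Y.k.hom := by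
  rw [Category.assoc, k_hom_comm, reassoc_of% f.d_comm]

end PointedSpan

/-! ### Comparison of two simple independence relations -/

namespace IndependenceRelation

lemma Union.ind_of_isColimit {R : IndependenceRelation C} (hR : R.Union) {J : Type w}
    [PartialOrder J] [IsDirectedOrder J] [Nonempty J] {G : J ⥤ Model C} {c : Cocone G}
    (hc : IsColimit c) {N : Model C} {A D : C} {a : A ⟶ N.obj} {t : c.pt.obj ⟶ N.obj}
    {d : D ⟶ N.obj} (h : ∀ j, R.Ind a ((c.ι.app j).hom ≫ t) d) : R.Ind a t d :=
  hR N _ _ J (G ⋙ isModel.ι) (isModel.ι.mapCocone c) (isColimitOfPreserves isModel.ι hc) t h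

namespace IsSimple

variable {R R₁ R₂ : IndependenceRelation C} {A B D : C}

/-- The length `J` is the initial ordinal of a regular cardinal: well-ordered, so that chains can be
built along it, and filtered enough for local character. It depends on `A` and `R` only, hence can
be fixed before the chain. -/
lemma exists_cardinal_model (hR : R.IsSimple) (A : C) :
    ∃ (J : Type w) (_ : LinearOrder J) (_ : Nonempty J) (_ : WellFoundedLT J) (_ : NoMaxOrder J),
      ∀ (G : J ⥤ Model C) (c : Cocone G) (_ : IsColimit c) (M : Model C)
        (a : A ⟶ M.obj) (b : c.pt.obj ⟶ M.obj), ∃ j : J, R.Ind a b ((c.ι.app j).hom ≫ b) := by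
  obtain ⟨κ, hκ, h⟩ := hR.exists_cardinal A
  have : Nonempty κ.ord.ToType := by simpa using hκ.out.ne_zero
  exact ⟨κ.ord.ToType, inferInstance, this, inferInstance,
    Cardinal.noMaxOrder hκ.out.aleph0_le, fun G c hc M a b ↦
      h κ.ord.ToType (G ⋙ isModel.ι) (isModel.ι.mapCocone c) (isColimitOfPreserves isModel.ι hc) M
        a b⟩

/-- Successor step of the chains: `f` makes `N` the next model, while `g` moves `b` off it, fixing
`M`. Transitivity lowers the base from `M` to `D`. -/
lemma ind_extend (hR : R.IsSimple) {M N N' : Model C} {m : M.obj ⟶ N.obj} {b : B ⟶ N.obj}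
    {d : D ⟶ M.obj} {f g : N.obj ⟶ N'.obj} (h : R.Ind b m (d ≫ m)) (hfg : m ≫ f = m ≫ g)
    (h' : R.Ind (b ≫ g) f (m ≫ f)) : R.Ind (b ≫ g) f (d ≫ m ≫ f) := by
  refine hR.ind_trans d ?_ h'
  have := hR.invariance.ind_comp h g
  rwa [Category.assoc, ← hfg] at this

lemma ind_b_of_isColimit (hR : R.IsSimple) {J : Type w} [PartialOrder J] [IsDirectedOrder J]
    [Nonempty J] {F : J ⥤ PointedSpan D B A} {c : Cocone F} (hc : IsColimit c)
    (h : ∀ j, R.Ind (F.obj j).b (F.obj j).m.hom ((F.obj j).d ≫ (F.obj j).m.hom)) :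
    R.Ind c.pt.b c.pt.m.hom (c.pt.d ≫ c.pt.m.hom) := by
  refine hR.union.ind_of_isColimit (isColimitOfPreserves PointedSpan.projM hc) fun j ↦ ?_
  let f : F.obj j ⟶ c.pt := c.ι.app j
  have := hR.invariance.ind_comp (h j) f.N.hom
  rwa [f.b_comm, PointedSpan.m_hom_comm, PointedSpan.d_m_comm] at this

lemma ind_a_of_isColimit (hR : R.IsSimple) {J : Type w} [PartialOrder J] [IsDirectedOrder J]
    [Nonempty J] {F : J ⥤ PointedSpan D B A} {c : Cocone F} (hc : IsColimit c)
    (h : ∀ j, R.Ind (F.obj j).a (F.obj j).k.hom ((F.obj j).d ≫ (F.obj j).k.hom)) :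
    R.Ind c.pt.a c.pt.k.hom (c.pt.d ≫ c.pt.k.hom) := by
  refine hR.union.ind_of_isColimit (isColimitOfPreserves PointedSpan.projM hc) fun j ↦ ?_
  let f : F.obj j ⟶ c.pt := c.ι.app j
  have := hR.invariance.ind_comp (h j) f.K.hom
  rwa [f.a_comm, PointedSpan.k_hom_comm, PointedSpan.d_k_comm] at this

/-- Over a model, extensions independent for two simple independence relations at once. -/
lemma exists_ind_ind (hAP : AmalgamationProperty C) (h₁ : R₁.IsSimple)
    (h₂ : R₂.IsSimple) {M₀ N₀ : Model C}
    (m₀ : M₀.obj ⟶ N₀.obj) (b : B ⟶ N₀.obj) :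
    ∃ (N : Model C) (f g : N₀.obj ⟶ N.obj), m₀ ≫ f = m₀ ≫ g ∧
      R₁.Ind (b ≫ g) f (m₀ ≫ f) ∧ R₂.Ind (b ≫ g) f (m₀ ≫ f) := by
  obtain ⟨J, _, _, _, _, hJ⟩ := h₂.exists_cardinal_model B
  obtain ⟨F, c, hc, ⟨-, hc'⟩, hF, hF'⟩ := PointedSpan.exists_chain
    -- The copies along the chain are of all of `N₀`; the third model is only carried along by
    -- amalgamation.
    (D := M₀.obj) (B := N₀.obj) (A := N₀.obj)
    (fun X ↦ R₂.Ind X.b X.m.hom (X.d ≫ X.m.hom) ∧ m₀ ≫ X.b = X.d ≫ X.m.hom)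
    (fun X Y f ↦ ∃ e : X.N.obj ⟶ Y.M.obj, X.m.hom ≫ e = f.M.hom)
    (fun J _ _ F c hc h ↦ by
      refine ⟨h₂.ind_b_of_isColimit hc fun j ↦ (h j).1, ?_⟩
      let f : F.obj (Classical.arbitrary J) ⟶ c.pt := c.ι.app _
      rw [← f.b_comm, ← PointedSpan.d_m_comm f, reassoc_of% (h _).2, Category.assoc])
    (fun X ⟨hX, hX'⟩ ↦ by
      obtain ⟨N, f, g, hfg, h⟩ := h₂.exists_ind X.b (𝟙 _) X.m.hom
      obtain ⟨K, p, q, hpq⟩ := hAP X.M X.N X.K X.m.hom X.k.hom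
      rw [Category.id_comp] at h
      refine ⟨⟨X.N, N, K, ObjectProperty.homMk f, ObjectProperty.homMk p, X.d ≫ X.m.hom,
        X.b ≫ g, X.a ≫ q⟩, ⟨X.m, ObjectProperty.homMk g, ObjectProperty.homMk q,
        ObjectProperty.hom_ext _ hfg.symm, ObjectProperty.hom_ext _ hpq.symm, rfl, rfl, rfl⟩,
        ⟨?_, ?_⟩, 𝟙 _, Category.comp_id _⟩
      · simpa using h₂.ind_extend hX hfg h
      · simp [reassoc_of% hX', hfg])
    ⟨M₀, N₀, N₀, ObjectProperty.homMk m₀, ObjectProperty.homMk m₀, 𝟙 _, 𝟙 _, 𝟙 _⟩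
    ⟨by simpa using h₂.ind_base (𝟙 N₀.obj) m₀, by simp⟩ J
  obtain ⟨N, f, g, hfg, h⟩ := h₁.exists_ind (b ≫ c.pt.b) c.pt.m.hom (c.pt.d ≫ c.pt.m.hom)
  obtain ⟨i, hi⟩ := hJ (F ⋙ PointedSpan.projM) _ (isColimitOfPreserves PointedSpan.projM hc)
    N ((b ≫ c.pt.b) ≫ g) (c.pt.m.hom ≫ f)
  obtain ⟨j, s, e, he⟩ := hF' i
  let pi : F.obj i ⟶ c.pt := c.ι.app i
  let pj : F.obj j ⟶ c.pt := c.ι.app j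
  have hij : F.map s ≫ pj = pi := c.w s
  change R₂.Ind (B := c.pt.M.obj) _ (c.pt.m.hom ≫ f) (pi.M.hom ≫ c.pt.m.hom ≫ f) at hi
  obtain ⟨t, ht⟩ : ∃ t : (F.obj i).N.obj ⟶ N.obj, t = e ≫ pj.M.hom ≫ c.pt.m.hom ≫ f :=
    ⟨_, rfl⟩
  have hmt : (F.obj i).m.hom ≫ t = pi.M.hom ≫ c.pt.m.hom ≫ f := by
    rw [ht, reassoc_of% he, ← hij]
    exact (Category.assoc _ _ _).symm
  have hdt : (F.obj i).d ≫ (F.obj i).m.hom ≫ t = c.pt.d ≫ c.pt.m.hom ≫ f := by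
    rw [hmt, reassoc_of% pi.d_comm]
  have hbt : m₀ ≫ (F.obj i).b ≫ t = c.pt.d ≫ c.pt.m.hom ≫ f := by
    rw [reassoc_of% (hF i).2, hdt]
  -- The copy of `N₀` placed in the chain just after stage `i` serves as `f`; `g` is the embedding
  -- whose restriction to `B` is independent from the whole chain for `R₁`.
  refine ⟨N, (F.obj i).b ≫ t, c.pt.b ≫ g, ?_, ?_, ?_⟩
  · rw [hbt, reassoc_of% hc']
    simpa using hfg
  · rw [hbt, ← Category.assoc b]
    have := h₁.monotonicity.ind h ((F.obj i).b ≫ e ≫ pj.M.hom)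
    simpa [ht] using this
  · rw [hbt, ← Category.assoc b]
    have h' := h₂.monotonicity.ind hi ((F.obj i).b ≫ e ≫ pj.M.hom)
    have h'' := h₂.invariance.ind_comp (hF i).1 t
    apply h₂.ind_symm
    rw [← hdt, hmt]
    refine h₂.ind_trans (F.obj i).d ?_ ?_
    · rwa [Category.assoc, hmt] at h''
    · apply h₂.ind_symm
      simpa [ht] using h'

/-- Comparison of two simple independence relations over a model. -/
lemma ind_of_ind_model (hAP : AmalgamationProperty C) (h₁ : R₁.IsSimple) (h₂ : R₂.IsSimple)
    {M₀ K₀ : Model C} {a₀ : A ⟶ K₀.obj} {b₀ : B ⟶ K₀.obj} {m₀ : M₀.obj ⟶ K₀.obj}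
    (h₀ : R₂.Ind a₀ b₀ m₀) : R₁.Ind a₀ b₀ m₀ := by
  obtain ⟨J, _, _, _, _, hJ⟩ := h₁.exists_cardinal_model A
  obtain ⟨F, c, hc, -, hF, hF'⟩ := PointedSpan.exists_chain
    (D := M₀.obj) (B := B) (A := A)
    (fun X ↦ R₁.Ind X.b X.m.hom (X.d ≫ X.m.hom) ∧ R₂.Ind X.b X.m.hom (X.d ≫ X.m.hom) ∧
      R₂.Ind X.a X.k.hom (X.d ≫ X.k.hom) ∧ SameGaloisType X.b (X.d ≫ X.m.hom) b₀ m₀ ∧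
      SameGaloisType X.a (X.d ≫ X.k.hom) a₀ m₀)
    (fun X Y f ↦ ∃ (e : X.N.obj ⟶ Y.M.obj) (g : K₀.obj ⟶ Y.K.obj), X.m.hom ≫ e = f.M.hom ∧
      a₀ ≫ g = Y.a ∧ b₀ ≫ g = X.b ≫ e ≫ Y.k.hom ∧ m₀ ≫ g = Y.d ≫ Y.k.hom)
    (fun J _ _ F c hc h ↦ by
      refine ⟨h₁.ind_b_of_isColimit hc fun j ↦ (h j).1,
        h₂.ind_b_of_isColimit hc fun j ↦ (h j).2.1,
        h₂.ind_a_of_isColimit hc fun j ↦ (h j).2.2.1, ?_, ?_⟩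
      · let f : F.obj (Classical.arbitrary J) ⟶ c.pt := c.ι.app _
        rw [← f.b_comm, ← PointedSpan.d_m_comm f]
        exact (h _).2.2.2.1.comp hAP _
      · let f : F.obj (Classical.arbitrary J) ⟶ c.pt := c.ι.app _
        rw [← f.a_comm, ← PointedSpan.d_k_comm f]
        exact (h _).2.2.2.2.comp hAP _)
    (fun X ⟨hX₁, hX₂, hXa, hXb', hXa'⟩ ↦ by
      obtain ⟨N, f, g, hfg, h₁', h₂'⟩ := exists_ind_ind hAP h₁ h₂ X.m.hom X.b
      obtain ⟨U, u, v, huv⟩ := hAP X.M X.N X.K X.m.hom X.k.hom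
      -- The three sides are `(a, b)` in `K₀`, `(b, M_i)` in `X.N` and `(M_i, a)` in `X.K`. Since
      -- `X.N` is the next model of the chain, independence from all of `X.N` is exactly what the
      -- next stage requires.
      obtain ⟨K, f₁, f₂, f₃, ha, hb, hm, hm₀, hm₀', h⟩ := h₂.threeAmalgamation A B X.M.obj M₀
        K₀ X.N X.K a₀ b₀ m₀ X.b X.m.hom (X.d ≫ X.m.hom) X.k.hom X.a (X.d ≫ X.k.hom)
        h₀ hX₂ (h₂.ind_symm hXa) hXa'.symm hXb'.symm
        ⟨U, u, v, huv, by simp [huv]⟩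
      refine ⟨⟨X.N, N, K, ObjectProperty.homMk f, ObjectProperty.homMk f₂, X.d ≫ X.m.hom,
        X.b ≫ g, X.a ≫ f₃⟩, ⟨X.m, ObjectProperty.homMk g, ObjectProperty.homMk f₃,
        ObjectProperty.hom_ext _ hfg.symm, ObjectProperty.hom_ext _ hm.symm, rfl, rfl, rfl⟩,
        ⟨?_, ?_, ?_, ?_, ?_⟩, 𝟙 _, f₁, Category.comp_id _, ha, ?_, ?_⟩
      · simpa using h₁.ind_extend hX₁ hfg h₁'
      · simpa using h₂.ind_extend hX₂ hfg h₂'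
      · change R₂.Ind _ _ _ at h
        rwa [ha, hm₀] at h
      · have := hXb'.comp hAP g
        rwa [Category.assoc, ← hfg, ← Category.assoc] at this
      · exact ⟨K, 𝟙 _, f₁, by simp [ha], by simp [hm₀]⟩
      · simpa using hb
      · exact hm₀)
    ⟨M₀, K₀, K₀, ObjectProperty.homMk m₀, ObjectProperty.homMk m₀, 𝟙 _, b₀, a₀⟩
    ⟨by simpa using h₁.ind_base b₀ m₀, by simpa using h₂.ind_base b₀ m₀,
      by simpa using h₂.ind_base a₀ m₀, ⟨K₀, 𝟙 _, 𝟙 _, by simp, by simp⟩,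
      ⟨K₀, 𝟙 _, 𝟙 _, by simp, by simp⟩⟩ J
  obtain ⟨i, hi⟩ := hJ (F ⋙ PointedSpan.projM) _ (isColimitOfPreserves PointedSpan.projM hc)
    c.pt.K c.pt.a c.pt.k.hom
  obtain ⟨j, s, e, g, he, hga, hgb, hgm⟩ := hF' i
  let pi : F.obj i ⟶ c.pt := c.ι.app i
  let pj : F.obj j ⟶ c.pt := c.ι.app j
  have hij : F.map s ≫ pj = pi := c.w s
  change R₁.Ind (B := c.pt.M.obj) _ c.pt.k.hom (pi.M.hom ≫ c.pt.k.hom) at hi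
  have hmt : (F.obj i).m.hom ≫ e ≫ pj.M.hom ≫ c.pt.k.hom = pi.M.hom ≫ c.pt.k.hom := by
    rw [reassoc_of% he, ← hij]
    exact (Category.assoc _ _ _).symm
  have hdt : (F.obj i).d ≫ pi.M.hom ≫ c.pt.k.hom = m₀ ≫ g ≫ pj.K.hom := by
    rw [reassoc_of% hgm, reassoc_of% pi.d_comm, PointedSpan.k_hom_comm, reassoc_of% pj.d_comm]
  have hbt : (F.obj i).b ≫ e ≫ pj.M.hom ≫ c.pt.k.hom = b₀ ≫ g ≫ pj.K.hom := by
    rw [reassoc_of% hgb, PointedSpan.k_hom_comm]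
  have hat : c.pt.a = a₀ ≫ g ≫ pj.K.hom := by rw [reassoc_of% hga, pj.a_comm]
  apply h₁.invariance.ind_of_comp (g ≫ pj.K.hom)
  apply h₁.ind_symm
  rw [← hat, ← hbt, ← hdt]
  refine h₁.ind_trans (F.obj i).d ?_ ?_
  · have := h₁.invariance.ind_comp (hF i).1 (e ≫ pj.M.hom ≫ c.pt.k.hom)
    rwa [Category.assoc, hmt] at this
  · apply h₁.ind_symm
    simpa using h₁.monotonicity.ind hi ((F.obj i).b ≫ e ≫ pj.M.hom)

/-- Comparison of two simple independence relations over an arbitrary base. -/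
lemma ind_of_ind (hAP : AmalgamationProperty C) (h₁ : R₁.IsSimple) (h₂ : R₂.IsSimple)
    {M : Model C} {a : A ⟶ M.obj} {b : B ⟶ M.obj} {d : D ⟶ M.obj} (h : R₂.Ind a b d) :
    R₁.Ind a b d := by
  -- Transitivity with `a` independent from `d` over `d` replaces `b` by a subobject above both `b`
  -- and `d`.
  wlog hx : ∃ x : D ⟶ B, x ≫ b = d generalizing B M
  · obtain ⟨N, f, E, t, y, z, h', hy, hz⟩ := h₂.exists_ind_trans (e := b) (𝟙 D)
      (by simpa using h₂.ind_base a d) h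
    rw [Category.id_comp] at h'
    have := h₁.monotonicity.ind (this h' ⟨y, hy⟩) z
    rw [hz] at this
    exact h₁.invariance.ind_of_comp f this
  obtain ⟨x, rfl⟩ := hx
  -- The copy of `M` under `f` is the model that serves as intermediate base: `b` is
  -- `R₁`-independent from it over `d`, and below `a` is moved over `b` to be `R₂`-independent from
  -- it over `b`.
  obtain ⟨M₀, f, g, hfg, hb⟩ := h₁.exists_ind b (𝟙 M.obj) (x ≫ b)
  rw [Category.id_comp] at hb
  simp only [Category.assoc] at hfg hb
  obtain ⟨N, p, q, hpq, ha⟩ := h₂.exists_ind (a ≫ g) f (b ≫ g)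
  simp only [Category.assoc] at hpq ha
  have h' := h₂.invariance.ind_comp h (g ≫ q)
  rw [Category.assoc, ← hpq] at h'
  obtain ⟨N', r, E, t, y, z, h'', hy, hz⟩ := h₂.exists_ind_trans x h' ha
  have h₃ : R₂.Ind (a ≫ g ≫ q ≫ r) (b ≫ g ≫ p ≫ r) (f ≫ p ≫ r) := by
    have := h₂.baseMonotonicity _ _ _ _ (Subobject.mk (f ≫ p ≫ r)) h''
      (Subobject.mk_le_mk_of_comm (x ≫ b) (by simp [reassoc_of% hfg]))
      (Subobject.mk_le_mk_of_comm z (by simp [hz]))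
    simpa [hy] using h₂.monotonicity.ind this y
  have h₄ := h₁.ind_symm (ind_of_ind_model (M₀ := M) hAP h₁ h₂ h₃)
  have h₅ := h₁.invariance.ind_comp hb (p ≫ r)
  simp only [Category.assoc] at h₅
  have h₆ := h₁.ind_trans (x ≫ b) (by simpa using h₅) h₄
  apply h₁.invariance.ind_of_comp (g ≫ q ≫ r)
  apply h₁.ind_symm
  rw [Category.assoc, ← reassoc_of% hpq]
  simpa [reassoc_of% hfg] using h₆

end IsSimple

end IndependenceRelation

end AECat

theorem mainTheorem2 {C : Type u} [Category.{w} C] [AECat.{w, u} C]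
    (hAP : AECat.AmalgamationProperty C) (R₁ R₂ : AECat.IndependenceRelation C)
    (h₁ : AECat.IndependenceRelation.IsSimple R₁) (h₂ : AECat.IndependenceRelation.IsSimple R₂) :
    R₁ = R₂ := by
  have key {R₁ R₂ : AECat.IndependenceRelation C} (h₁ : R₁.IsSimple) (h₂ : R₂.IsSimple)
      (M : AECat.Model C) (A B D : Subobject M.obj) (h : R₂ M A B D) : R₁ M A B D := by
    rw [← Subobject.mk_arrow A, ← Subobject.mk_arrow B, ← Subobject.mk_arrow D] at h ⊢
    exact h₁.ind_of_ind hAP h₂ h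
  funext M A B D
  exact propext ⟨key h₂ h₁ M A B D, key h₁ h₂ M A B D⟩
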